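/- Let $C\in\mathbb{R}^{n\times k}$ satisfy $\|Cu\|_2\le 1$ for all $u\in\{-1,1\}^k$, and let $G\in\mathbb{R}^{k\times d}$ have rows $G_{1},\dots,G_{k}\in\mathbb{R}^d$. Write $\|\cdot\|_F$ for the Frobenius norm. (a) Suppose $\|G_{i}\|_2\le 1$ for every $i$. If at least one of the following conditions holds, then $\|CG\|_F\le 1$: 1. $k\le 2$; 2. all entries of $C^\top C$ are non-negative; 3. the rows of $G$ are colinear, i.e. they are all scalar multiples of a single vector $v\in\mathbb{R}^d$ (in particular, if $G_{i}=u_iG_{1}$ with $u_i\in\{-1,1\}$ for all $i>1$); 4. the rows of $G$ are pairwise orthogonal, i.e. $\langle G_{i},G_{j}\rangle=0$ for all $i\ne j$. (b) If $\|G_{i}\|_2\le 1$ for every $i$, then, without any of the conditions 1–4, $\|CG\|_F\le \pi/2$. (c) If instead $\|G_{i}\|_1\le 1$ for every $i$, then, without any of the conditions 1–4, $\|CG\|_F\le 1$. -/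

import Mathlib

open scoped Matrix Matrix.Norms.Frobenius

open MeasureTheory ProbabilityTheory
open scoped RealInnerProductSpace NNReal

/-! With `c i` the columns of `C`, `‖C * G‖ ^ 2` is the sum of `⟪c i, c j⟫ * ⟪G i, G j⟫`, so only
the two Gram matrices matter. By convexity the hypothesis on signs extends to the cube `[-1, 1]^k`,
and outside (b) the sum is compared with `‖C u‖ ^ 2` at one point `u` of the cube. For (c), suitable
signs `e` on the columns of `C * G` give `‖C * G‖ ≤ ‖C (G e)‖`, and `G e` lies in the cube.
Orthogonal rows reduce to this case, since a diagonal matrix has the same Gram matrix. For colinear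
rows, `u` lists their signed lengths; conditions 1 and 2 supply signs making every term nonnegative.
Part (b) is the little Grothendieck inequality, `sum_inner_mul_inner_le_pi_div_two`, proved by
Gaussian rounding. -/

lemma integral_abs_gaussianReal_zero (v : ℝ≥0) :
    ∫ t, |t| ∂gaussianReal 0 v = √(2 / Real.pi) * √v := by
  rcases eq_or_ne v 0 with rfl | hv
  · simp
  have hv' : (0 : ℝ) < v := by positivity
  rw [integral_gaussianReal_eq_integral_smul hv]
  -- The integrand is even; real powers match the half-line Gamma integral.
  let f : ℝ → ℝ := fun s =>
    (√(2 * Real.pi * v))⁻¹ * (s ^ (1 : ℝ) * Real.exp (-(1 / (2 * v)) * s ^ (2 : ℝ)))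
  have h1 : ∀ t : ℝ, gaussianPDFReal 0 v t • |t| = f |t| := by
    intro t
    simp only [f, gaussianPDFReal, sub_zero, smul_eq_mul, Real.rpow_one, Real.rpow_two, sq_abs]
    rw [show -(1 / (2 * (v : ℝ))) * t ^ 2 = -t ^ 2 / (2 * v) by ring]
    ring
  simp_rw [h1]
  rw [integral_comp_abs (f := f), integral_const_mul,
    integral_rpow_mul_exp_neg_mul_rpow (by norm_num) (by norm_num) (by positivity)]
  rw [show (-((1 : ℝ) + 1) / 2) = -1 by norm_num, show ((1 : ℝ) + 1) / 2 = 1 by norm_num,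
    Real.Gamma_one, Real.rpow_neg_one, ← Real.sqrt_inv]
  rw [← Real.sqrt_mul (by positivity)]
  rw [show 2 / Real.pi * (v : ℝ) = (2 * Real.pi * v)⁻¹ * (2 * v) ^ 2 by field_simp,
    Real.sqrt_mul (by positivity), Real.sqrt_sq (by positivity)]
  field_simp

/-! ### Gaussian rounding and the little Grothendieck inequality -/

section Gaussian

variable {E : Type*} [NormedAddCommGroup E] [InnerProductSpace ℝ E] [FiniteDimensional ℝ E]
  [MeasurableSpace E] [BorelSpace E]

lemma memLp_inner_stdGaussian (x : E) : MemLp (fun g => ⟪x, g⟫) 2 (stdGaussian E) :=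
  IsGaussian.memLp_dual _ (innerSL ℝ x) 2 (by simp)

lemma integral_inner_mul_inner_stdGaussian (x y : E) :
    ∫ g, ⟪x, g⟫ * ⟪y, g⟫ ∂stdGaussian E = ⟪x, y⟫ := by
  have h := covarianceBilin_apply (μ := stdGaussian E) IsGaussian.memLp_two_id x y
  rw [covarianceBilin_stdGaussian, innerSL_apply_apply ℝ] at h
  simpa using h.symm

lemma integral_abs_inner_stdGaussian (x : E) :
    ∫ g, |⟪x, g⟫| ∂stdGaussian E = √(2 / Real.pi) * ‖x‖ := by
  have h := IsGaussian.map_eq_gaussianReal (μ := stdGaussian E) (innerSL ℝ x)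
  rw [integral_strongDual_stdGaussian, variance_dual_stdGaussian, innerSL_apply_norm] at h
  have h2 : ∫ g, |⟪x, g⟫| ∂stdGaussian E = ∫ t, |t| ∂((stdGaussian E).map (innerSL ℝ x)) := by
    rw [integral_map (by fun_prop) (by fun_prop)]
    rfl
  rw [h2, h, integral_abs_gaussianReal_zero]
  simp

lemma integrable_sign_mul_inner_stdGaussian (x y : E) :
    Integrable (fun g => Real.sign ⟪x, g⟫ * ⟪y, g⟫) (stdGaussian E) := by
  refine ((memLp_inner_stdGaussian y).integrable (by norm_num)).bdd_mul (c := 1) ?_ ?_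
  · have : Measurable Real.sign := by
      unfold Real.sign
      exact Measurable.ite measurableSet_Iio measurable_const
        (Measurable.ite measurableSet_Ioi measurable_const measurable_const)
    exact (this.comp (by fun_prop)).aestronglyMeasurable
  · refine .of_forall fun g => ?_
    rcases Real.sign_apply_eq ⟪x, g⟫ with h | h | h <;> simp [h]

/-- Reflection in the line of `x` preserves the Gaussian, fixes `x` and negates `y`, so the integral
equals its own negative. -/
lemma integral_sign_mul_inner_of_inner_eq_zero {x y : E} (hxy : ⟪x, y⟫ = 0) :
    ∫ g, Real.sign ⟪x, g⟫ * ⟪y, g⟫ ∂stdGaussian E = 0 := by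
  set f : E ≃ₗᵢ[ℝ] E := (ℝ ∙ x).reflection with hf
  have hfx : f x = x := Submodule.reflection_mem_subspace_eq_self (Submodule.mem_span_singleton_self x)
  have hfy : f y = -y := Submodule.reflection_mem_subspace_orthogonalComplement_eq_neg
    (Submodule.mem_orthogonal_singleton_iff_inner_right.2 hxy)
  have hx (g : E) : ⟪x, f g⟫ = ⟪x, g⟫ := by
    conv_lhs => rw [← hfx]
    exact f.inner_map_map x g
  have hy (g : E) : ⟪y, f g⟫ = -⟪y, g⟫ := by
    have := f.inner_map_map y g
    rw [hfy, inner_neg_left] at this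
    linarith
  have h : ∫ g, Real.sign ⟪x, g⟫ * ⟪y, g⟫ ∂stdGaussian E =
      ∫ g, Real.sign ⟪x, f g⟫ * ⟪y, f g⟫ ∂stdGaussian E := by
    conv_lhs => rw [← stdGaussian_map f]
    exact f.toHomeomorph.toMeasurableEquiv.measurableEmbedding.integral_map _
  simp_rw [hx, hy, mul_neg] at h
  rw [integral_neg] at h
  linarith

/-- The polar part of `⟪x, g⟫` correlates with every linear functional of the Gaussian vector `g`
as `x` itself does, up to the factor `√(2 / π)`. -/
lemma integral_norm_mul_sign_mul_inner_stdGaussian (x y : E) :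
    ∫ g, ‖x‖ * (Real.sign ⟪x, g⟫ * ⟪y, g⟫) ∂stdGaussian E = √(2 / Real.pi) * ⟪x, y⟫ := by
  rcases eq_or_ne x 0 with rfl | hx
  · simp
  have hx' : ‖x‖ ≠ 0 := norm_ne_zero_iff.2 hx
  -- `a • x` is the orthogonal projection of `y` onto the line of `x`.
  set a : ℝ := ⟪x, y⟫ / ‖x‖ ^ 2 with ha
  have hw : ⟪x, y - a • x⟫ = 0 := by
    rw [inner_sub_right, real_inner_smul_right, real_inner_self_eq_norm_sq, ha]
    field_simp
    ring
  have h1 (g : E) : Real.sign ⟪x, g⟫ * ⟪y, g⟫ =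
      a * |⟪x, g⟫| + Real.sign ⟪x, g⟫ * ⟪y - a • x, g⟫ := by
    have : |⟪x, g⟫| = Real.sign ⟪x, g⟫ * ⟪x, g⟫ := by
      rcases lt_trichotomy ⟪x, g⟫ 0 with h | h | h
      · rw [Real.sign_of_neg h, abs_of_neg h]; ring
      · simp [h]
      · rw [Real.sign_of_pos h, abs_of_pos h]; ring
    rw [this, inner_sub_left, real_inner_smul_left]
    ring
  rw [integral_const_mul]
  simp_rw [h1]
  rw [integral_add _ (integrable_sign_mul_inner_stdGaussian _ _),
    integral_sign_mul_inner_of_inner_eq_zero hw, integral_const_mul,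
    integral_abs_inner_stdGaussian, ha]
  · field_simp
    ring
  · exact (((memLp_inner_stdGaussian x).integrable (by norm_num)).abs).const_mul a

/-- The little Grothendieck inequality: a bound on the images of the cube `[-1, 1]^ι` passes to
families of vectors in the unit ball, at the cost of the factor `π / 2`. -/
lemma sum_inner_mul_inner_le_pi_div_two {ι H : Type*} [Fintype ι] [NormedAddCommGroup H]
    [InnerProductSpace ℝ H] (c : ι → H)
    (hc : ∀ u : ι → ℝ, (∀ i, |u i| ≤ 1) → ‖∑ i, u i • c i‖ ≤ 1)
    (x : ι → E) (hx : ∀ i, ‖x i‖ ≤ 1) :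
    ∑ i, ∑ j, ⟪c i, c j⟫ * ⟪x i, x j⟫ ≤ Real.pi / 2 := by
  set S := ∑ i, ∑ j, ⟪c i, c j⟫ * ⟪x i, x j⟫ with hS
  set r := √(2 / Real.pi) with hr
  have hr2 : r ^ 2 = 2 / Real.pi := Real.sq_sqrt (by positivity)
  have hbil (a b : ι → ℝ) : ⟪∑ i, a i • c i, ∑ j, b j • c j⟫ =
      ∑ i, ∑ j, ⟪c i, c j⟫ * (a i * b j) := by
    simp_rw [sum_inner, inner_sum, real_inner_smul_left, real_inner_smul_right]
    exact Finset.sum_congr rfl fun i _ => Finset.sum_congr rfl fun j _ => by ring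
  -- This is `0 ≤ ‖p - r • q‖ ^ 2` with `‖p‖ ≤ 1`. Integrated, it reads `2 * r ^ 2 * S ≤ 1 + r ^ 2 *
  -- S`, hence `S ≤ 1 / r ^ 2 = π / 2`.
  have hpt (g : E) :
      2 * r * ∑ i, ∑ j, ⟪c i, c j⟫ * (‖x i‖ * (Real.sign ⟪x i, g⟫ * ⟪x j, g⟫)) ≤
        1 + r ^ 2 * ∑ i, ∑ j, ⟪c i, c j⟫ * (⟪x i, g⟫ * ⟪x j, g⟫) := by
    set p := ∑ i, (‖x i‖ * Real.sign ⟪x i, g⟫) • c i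
    set q := ∑ j, ⟪x j, g⟫ • c j
    have hp : ‖p‖ ≤ 1 := by
      refine hc _ fun i => ?_
      rw [abs_mul, abs_norm]
      refine mul_le_one₀ (hx i) (abs_nonneg _) ?_
      rcases Real.sign_apply_eq ⟪x i, g⟫ with h | h | h <;> simp [h]
    have h1 : ⟪p, q⟫ = ∑ i, ∑ j, ⟪c i, c j⟫ * (‖x i‖ * (Real.sign ⟪x i, g⟫ * ⟪x j, g⟫)) := by
      rw [hbil]; simp_rw [mul_assoc]
    have h2 : ‖q‖ ^ 2 = ∑ i, ∑ j, ⟪c i, c j⟫ * (⟪x i, g⟫ * ⟪x j, g⟫) := by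
      rw [← real_inner_self_eq_norm_sq, hbil]
    rw [← h1, ← h2]
    have h3 : ‖p - r • q‖ ^ 2 = ‖p‖ ^ 2 - 2 * (r * ⟪p, q⟫) + r ^ 2 * ‖q‖ ^ 2 := by
      rw [norm_sub_sq_real, real_inner_smul_right, norm_smul, mul_pow, Real.norm_eq_abs, sq_abs]
    have h4 : ‖p‖ ^ 2 ≤ 1 := pow_le_one₀ (norm_nonneg _) hp
    nlinarith [sq_nonneg ‖p - r • q‖]
  have hi1 (i j : ι) : Integrable
      (fun g => ⟪c i, c j⟫ * (‖x i‖ * (Real.sign ⟪x i, g⟫ * ⟪x j, g⟫))) (stdGaussian E) :=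
    ((integrable_sign_mul_inner_stdGaussian _ _).const_mul _).const_mul _
  have hi2 (i j : ι) : Integrable
      (fun g => ⟪c i, c j⟫ * (⟪x i, g⟫ * ⟪x j, g⟫)) (stdGaussian E) :=
    ((memLp_inner_stdGaussian _).integrable_mul (memLp_inner_stdGaussian _)).const_mul _
  have hI1 := integrable_finsetSum Finset.univ fun i _ =>
    integrable_finsetSum Finset.univ fun j _ => hi1 i j
  have hI2 := integrable_finsetSum Finset.univ fun i _ =>
    integrable_finsetSum Finset.univ fun j _ => hi2 i j
  have hmono := integral_mono (hI1.const_mul (2 * r))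
    ((integrable_const (1 : ℝ)).add (hI2.const_mul (r ^ 2))) hpt
  have e1 : ∫ g, ∑ i, ∑ j, ⟪c i, c j⟫ * (‖x i‖ * (Real.sign ⟪x i, g⟫ * ⟪x j, g⟫)) ∂stdGaussian E
      = r * S := by
    rw [integral_finsetSum _ fun i _ => integrable_finsetSum _ fun j _ => hi1 i j, hS,
      Finset.mul_sum]
    refine Finset.sum_congr rfl fun i _ => ?_
    rw [integral_finsetSum _ fun j _ => hi1 i j, Finset.mul_sum]
    refine Finset.sum_congr rfl fun j _ => ?_
    rw [integral_const_mul, integral_norm_mul_sign_mul_inner_stdGaussian]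
    ring
  have e2 : ∫ g, ∑ i, ∑ j, ⟪c i, c j⟫ * (⟪x i, g⟫ * ⟪x j, g⟫) ∂stdGaussian E = S := by
    rw [integral_finsetSum _ fun i _ => integrable_finsetSum _ fun j _ => hi2 i j, hS]
    refine Finset.sum_congr rfl fun i _ => ?_
    rw [integral_finsetSum _ fun j _ => hi2 i j]
    refine Finset.sum_congr rfl fun j _ => ?_
    rw [integral_const_mul, integral_inner_mul_inner_stdGaussian]
  have e3 : ∫ g, ((1 : ℝ) + r ^ 2 * ∑ i, ∑ j, ⟪c i, c j⟫ * (⟪x i, g⟫ * ⟪x j, g⟫)) ∂stdGaussian E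
      = 1 + r ^ 2 * S := by
    rw [integral_add (integrable_const _) (hI2.const_mul _), integral_const_mul, e2]
    simp
  rw [integral_const_mul, e1] at hmono
  replace hmono := hmono.trans_eq e3
  have h : r ^ 2 * S ≤ 1 := by linarith
  rw [hr2] at h
  have hpi := Real.pi_pos
  rw [div_mul_eq_mul_div, div_le_one hpi] at h
  linarith

end Gaussian

/-! ### Sign vectors and the cube -/

section Cube

variable {ι H : Type*} [Fintype ι]

lemma norm_sum_smul_le_of_forall_sign [NormedAddCommGroup H] [NormedSpace ℝ H] {c : ι → H}
    (hc : ∀ u : ι → ℝ, (∀ i, u i = -1 ∨ u i = 1) → ‖∑ i, u i • c i‖ ≤ 1)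
    (u : ι → ℝ) (hu : ∀ i, |u i| ≤ 1) : ‖∑ i, u i • c i‖ ≤ 1 := by
  have hmem : u ∈ convexHull ℝ (Set.univ.pi fun _ : ι => ({-1, 1} : Set ℝ)) := by
    rw [convexHull_pi]
    intro i _
    simp only [convexHull_pair]
    rw [segment_eq_Icc (by norm_num)]
    exact abs_le.1 (hu i)
  have hconv : Convex ℝ ((Fintype.linearCombination ℝ c) ⁻¹' Metric.closedBall (0 : H) 1) :=
    (convex_closedBall _ _).linear_preimage _
  have := convexHull_min (fun w hw => ?_) hconv hmem
  · simpa [Fintype.linearCombination_apply] using this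
  · simpa [Fintype.linearCombination_apply] using hc w (by simpa using hw)

variable [NormedAddCommGroup H] [InnerProductSpace ℝ H]

/-- Signs are chosen greedily, each making the cross term with the previous partial sum nonnegative.
-/
lemma exists_sign_sum_norm_sq_le (m : ι → H) :
    ∃ e : ι → ℝ, (∀ i, e i = -1 ∨ e i = 1) ∧ ∑ i, ‖m i‖ ^ 2 ≤ ‖∑ i, e i • m i‖ ^ 2 := by
  classical
  suffices h : ∀ s : Finset ι, ∃ e : ι → ℝ, (∀ i, e i = -1 ∨ e i = 1) ∧
      ∑ i ∈ s, ‖m i‖ ^ 2 ≤ ‖∑ i ∈ s, e i • m i‖ ^ 2 from h Finset.univ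
  intro s
  induction s using Finset.induction_on with
  | empty => exact ⟨fun _ => 1, by simp, by simp⟩
  | insert a s ha ih =>
    obtain ⟨e, he, hs⟩ := ih
    obtain ⟨r, hr, hr'⟩ : ∃ r : ℝ, (r = -1 ∨ r = 1) ∧ 0 ≤ r * ⟪m a, ∑ i ∈ s, e i • m i⟫ := by
      rcases le_total 0 ⟪m a, ∑ i ∈ s, e i • m i⟫ with h | h
      · exact ⟨1, .inr rfl, by simpa⟩
      · exact ⟨-1, .inl rfl, by simpa⟩
    refine ⟨Function.update e a r, fun i => ?_, ?_⟩
    · rcases eq_or_ne i a with rfl | hi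
      · simpa
      · simpa [hi] using he i
    · have hsum : ∑ i ∈ s, Function.update e a r i • m i = ∑ i ∈ s, e i • m i :=
        Finset.sum_congr rfl fun i hi => by
          rw [Function.update_of_ne (ne_of_mem_of_not_mem hi ha)]
      have hn : ‖r • m a‖ ^ 2 = ‖m a‖ ^ 2 := by rcases hr with rfl | rfl <;> simp
      rw [Finset.sum_insert ha, Finset.sum_insert ha, hsum, Function.update_self,
        norm_add_sq_real, hn, real_inner_smul_left]
      linarith

/-- If some choice of signs `u` makes all the `u i * u j * ⟪c i, c j⟫` nonnegative, then it
maximizes `∑ ⟪c i, c j⟫ * ⟪x i, x j⟫` over families `x` in the unit ball. -/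
lemma sum_inner_mul_inner_le_of_sign {E : Type*} [NormedAddCommGroup E] [InnerProductSpace ℝ E]
    (c : ι → H) {u : ι → ℝ} (hu : ∀ i, u i = -1 ∨ u i = 1)
    (hpos : ∀ i j, 0 ≤ u i * u j * ⟪c i, c j⟫) (x : ι → E) (hx : ∀ i, ‖x i‖ ≤ 1) :
    ∑ i, ∑ j, ⟪c i, c j⟫ * ⟪x i, x j⟫ ≤ ‖∑ i, u i • c i‖ ^ 2 := by
  rw [← real_inner_self_eq_norm_sq]
  simp_rw [sum_inner, inner_sum, real_inner_smul_left, real_inner_smul_right]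
  refine Finset.sum_le_sum fun i _ => Finset.sum_le_sum fun j _ => ?_
  have hx1 : |⟪x i, x j⟫| ≤ 1 :=
    (abs_real_inner_le_norm _ _).trans (mul_le_one₀ (hx i) (norm_nonneg _) (hx j))
  have hu1 : |u i * u j| = 1 := by
    rcases hu i with h | h <;> rcases hu j with h' | h' <;> simp [h, h']
  calc ⟪c i, c j⟫ * ⟪x i, x j⟫ ≤ |⟪c i, c j⟫ * ⟪x i, x j⟫| := le_abs_self _
    _ ≤ |⟪c i, c j⟫| := by
      rw [abs_mul]; exact mul_le_of_le_one_right (abs_nonneg _) hx1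
    _ = |u i * u j * ⟪c i, c j⟫| := by rw [abs_mul (u i * u j), hu1, one_mul]
    _ = u i * (u j * ⟪c i, c j⟫) := by rw [abs_of_nonneg (hpos i j)]; ring

end Cube

/-! ### Frobenius norms of products -/

section Matrix

variable {l m n : Type*} [Fintype l] [Fintype n]

lemma Matrix.toLp_mulVec_eq_sum (A : Matrix m n ℝ) (u : n → ℝ) :
    WithLp.toLp 2 (A *ᵥ u) = ∑ j, u j • WithLp.toLp 2 (A.col j) := by
  ext i
  simp [Matrix.mulVec, dotProduct, mul_comm]

lemma Matrix.inner_col_col (C : Matrix l m ℝ) (i j : m) :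
    ⟪WithLp.toLp 2 (C.col i), WithLp.toLp 2 (C.col j)⟫ = (Cᵀ * C) i j := by
  simp [PiLp.inner_apply, Matrix.mul_apply, mul_comm]

variable [Fintype m]

lemma Matrix.frobenius_norm_sq_eq_sum_col (A : Matrix m n ℝ) :
    ‖A‖ ^ 2 = ∑ j, ‖WithLp.toLp 2 (A.col j)‖ ^ 2 := by
  rw [Matrix.frobenius_norm_def, ← Real.sqrt_eq_rpow,
    Real.sq_sqrt (by positivity), Finset.sum_comm]
  refine Finset.sum_congr rfl fun j _ => ?_
  simp [EuclideanSpace.norm_sq_eq]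

lemma Matrix.frobenius_norm_mul_sq (C : Matrix l m ℝ) (G : Matrix m n ℝ) :
    ‖C * G‖ ^ 2 = ∑ i, ∑ j, ⟪WithLp.toLp 2 (C.col i), WithLp.toLp 2 (C.col j)⟫ *
      ⟪WithLp.toLp 2 (G.row i), WithLp.toLp 2 (G.row j)⟫ := by
  have h (t : n) : ‖WithLp.toLp 2 ((C * G).col t)‖ ^ 2 = ∑ i, ∑ j,
      ⟪WithLp.toLp 2 (C.col i), WithLp.toLp 2 (C.col j)⟫ * (G i t * G j t) := by
    have : (C * G).col t = C *ᵥ G.col t := rfl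
    rw [this, Matrix.toLp_mulVec_eq_sum, ← real_inner_self_eq_norm_sq]
    simp_rw [sum_inner, inner_sum, real_inner_smul_left, real_inner_smul_right]
    refine Finset.sum_congr rfl fun i _ => Finset.sum_congr rfl fun j _ => ?_
    simp only [Matrix.col_apply]
    ring
  rw [Matrix.frobenius_norm_sq_eq_sum_col]
  simp_rw [h]
  rw [Finset.sum_comm]
  refine Finset.sum_congr rfl fun i _ => ?_
  rw [Finset.sum_comm]
  refine Finset.sum_congr rfl fun j _ => ?_
  rw [← Finset.mul_sum]
  congr 1
  simp [PiLp.inner_apply, mul_comm]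

lemma Matrix.frobenius_norm_mul_le_one_of_l1_row {C : Matrix l m ℝ}
    (hC : ∀ u : m → ℝ, (∀ i, |u i| ≤ 1) → ‖WithLp.toLp 2 (C *ᵥ u)‖ ≤ 1)
    {G : Matrix m n ℝ} (hG : ∀ i, ‖WithLp.toLp 1 (G.row i)‖ ≤ 1) : ‖C * G‖ ≤ 1 := by
  obtain ⟨e, he, hle⟩ := exists_sign_sum_norm_sq_le fun t => WithLp.toLp 2 ((C * G).col t)
  rw [← Matrix.frobenius_norm_sq_eq_sum_col, ← Matrix.toLp_mulVec_eq_sum,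
    ← Matrix.mulVec_mulVec] at hle
  refine (pow_le_pow_iff_left₀ (norm_nonneg _) (norm_nonneg _) two_ne_zero).1 hle |>.trans ?_
  refine hC _ fun i => ?_
  -- Each coordinate of `G *ᵥ e` is a signed sum of a row, so the `ℓ¹` norm of that row bounds it.
  refine le_trans ?_ (hG i)
  rw [PiLp.norm_eq_of_L1]
  refine (Finset.abs_sum_le_sum_abs _ _).trans_eq (Finset.sum_congr rfl fun t _ => ?_)
  rcases he t with h | h <;> simp [h]

lemma Matrix.frobenius_norm_mul_le_one_of_orthogonal_row {C : Matrix l m ℝ}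
    (hC : ∀ u : m → ℝ, (∀ i, |u i| ≤ 1) → ‖WithLp.toLp 2 (C *ᵥ u)‖ ≤ 1)
    {G : Matrix m n ℝ} (hG : ∀ i, ‖WithLp.toLp 2 (G.row i)‖ ≤ 1)
    (horth : ∀ i j, i ≠ j → G.row i ⬝ᵥ G.row j = 0) : ‖C * G‖ ≤ 1 := by
  classical
  -- `D` has the Gram matrix of `G`, but its rows have a single entry, so their `ℓ¹` and `ℓ²` norms
  -- agree.
  set D : Matrix m m ℝ := Matrix.diagonal fun i => ‖WithLp.toLp 2 (G.row i)‖ with hD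
  have hrow (i : m) : D.row i = Pi.single i ‖WithLp.toLp 2 (G.row i)‖ := by
    ext j
    rcases eq_or_ne j i with rfl | h
    · simp [hD]
    · simp [hD, h, h.symm]
  have h1 : ‖C * D‖ ≤ 1 := Matrix.frobenius_norm_mul_le_one_of_l1_row hC fun i => by
    rw [hrow, ← PiLp.single, PiLp.norm_single]
    simpa using hG i
  suffices h : ‖C * G‖ ^ 2 = ‖C * D‖ ^ 2 by
    rw [(pow_left_inj₀ (norm_nonneg _) (norm_nonneg _) two_ne_zero).1 h]
    exact h1
  rw [Matrix.frobenius_norm_mul_sq, Matrix.frobenius_norm_mul_sq]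
  refine Finset.sum_congr rfl fun i _ => Finset.sum_congr rfl fun j _ => ?_
  congr 1
  rcases eq_or_ne i j with rfl | hij
  · rw [real_inner_self_eq_norm_sq, real_inner_self_eq_norm_sq, hrow, ← PiLp.single,
      PiLp.norm_single]
    simp
  · rw [EuclideanSpace.inner_toLp_toLp, EuclideanSpace.inner_toLp_toLp, hrow, hrow]
    simpa [hij] using horth j i hij.symm

lemma Matrix.frobenius_norm_mul_le_one_of_colinear_row {C : Matrix l m ℝ}
    (hC : ∀ u : m → ℝ, (∀ i, |u i| ≤ 1) → ‖WithLp.toLp 2 (C *ᵥ u)‖ ≤ 1)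
    {G : Matrix m n ℝ} (hG : ∀ i, ‖WithLp.toLp 2 (G.row i)‖ ≤ 1)
    (hcol : ∃ v : n → ℝ, ∀ i, ∃ a : ℝ, G.row i = a • v) : ‖C * G‖ ≤ 1 := by
  obtain ⟨v, hv⟩ := hcol
  choose a ha using hv
  have h1 : ‖WithLp.toLp 2 (C *ᵥ fun i => a i * ‖WithLp.toLp 2 v‖)‖ ≤ 1 := hC _ fun i => by
    have := hG i
    rw [ha, WithLp.toLp_smul, norm_smul, Real.norm_eq_abs] at this
    rwa [abs_mul, abs_norm]
  suffices h : ‖C * G‖ ^ 2 = ‖WithLp.toLp 2 (C *ᵥ fun i => a i * ‖WithLp.toLp 2 v‖)‖ ^ 2 by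
    rw [(pow_left_inj₀ (norm_nonneg _) (norm_nonneg _) two_ne_zero).1 h]
    exact h1
  rw [Matrix.frobenius_norm_mul_sq, Matrix.toLp_mulVec_eq_sum, ← real_inner_self_eq_norm_sq]
  simp_rw [ha, WithLp.toLp_smul, sum_inner, inner_sum, real_inner_smul_left,
    real_inner_smul_right, real_inner_self_eq_norm_sq]
  exact Finset.sum_congr rfl fun i _ => Finset.sum_congr rfl fun j _ => by ring

end Matrix

/-- At most one off-diagonal pair exists, and flipping one coordinate corrects its sign. -/
lemma exists_sign_mul_nonneg {k : ℕ} (hk : k ≤ 2) {A : Fin k → Fin k → ℝ}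
    (hdiag : ∀ i, 0 ≤ A i i) (hsymm : ∀ i j, A i j = A j i) :
    ∃ u : Fin k → ℝ, (∀ i, u i = -1 ∨ u i = 1) ∧ ∀ i j, 0 ≤ u i * u j * A i j := by
  interval_cases k
  · exact ⟨fun _ => 1, by simp, fun i => i.elim0⟩
  · refine ⟨fun _ => 1, by simp, fun i j => ?_⟩
    rw [Subsingleton.elim j i]
    simpa using hdiag i
  · rcases le_total 0 (A 0 1) with h | h
    · refine ⟨fun _ => 1, by simp, fun i j => ?_⟩
      fin_cases i <;> fin_cases j <;> simp [hdiag, h, hsymm 1 0]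
    · refine ⟨![1, -1], fun i => ?_, fun i j => ?_⟩
      · fin_cases i <;> simp
      · fin_cases i <;> fin_cases j <;> simp [hdiag, h, hsymm 1 0]

theorem mainTheorem3 (n k d : ℕ) (C : Matrix (Fin n) (Fin k) ℝ)
    (hC : ∀ u : Fin k → ℝ, (∀ i, u i = -1 ∨ u i = 1) → ‖WithLp.toLp 2 (C *ᵥ u)‖ ≤ 1)
    (G : Matrix (Fin k) (Fin d) ℝ) :
    ((∀ i, ‖WithLp.toLp 2 (G.row i)‖ ≤ 1) →
      ((k ≤ 2 ∨
        (∀ i j, 0 ≤ (Cᵀ * C) i j) ∨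
        (∃ v : Fin d → ℝ, ∀ i, ∃ a : ℝ, G.row i = a • v) ∨
        (∀ i j, i ≠ j → G.row i ⬝ᵥ G.row j = 0)) → ‖C * G‖ ≤ 1) ∧
      ‖C * G‖ ≤ Real.pi / 2) ∧
    ((∀ i, ‖WithLp.toLp 1 (G.row i)‖ ≤ 1) → ‖C * G‖ ≤ 1) := by
  have hcube : ∀ u : Fin k → ℝ, (∀ i, |u i| ≤ 1) →
      ‖∑ i, u i • WithLp.toLp 2 (C.col i)‖ ≤ 1 :=
    norm_sum_smul_le_of_forall_sign fun u hu => by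
      rw [← Matrix.toLp_mulVec_eq_sum]
      exact hC u hu
  have hcube' : ∀ u : Fin k → ℝ, (∀ i, |u i| ≤ 1) → ‖WithLp.toLp 2 (C *ᵥ u)‖ ≤ 1 :=
    fun u hu => by
      rw [Matrix.toLp_mulVec_eq_sum]
      exact hcube u hu
  refine ⟨fun hG => ⟨fun h => ?_, ?_⟩, Matrix.frobenius_norm_mul_le_one_of_l1_row hcube'⟩
  · have hsign (u : Fin k → ℝ) (hu : ∀ i, u i = -1 ∨ u i = 1)
        (hpos : ∀ i j, 0 ≤ u i * u j * (Cᵀ * C) i j) : ‖C * G‖ ≤ 1 := by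
      refine (pow_le_pow_iff_left₀ (norm_nonneg _) (norm_nonneg _) two_ne_zero).1 ?_ |>.trans
        (hC u hu)
      rw [Matrix.frobenius_norm_mul_sq, Matrix.toLp_mulVec_eq_sum]
      refine sum_inner_mul_inner_le_of_sign _ hu (fun i j => ?_) _ hG
      rw [Matrix.inner_col_col]
      exact hpos i j
    rcases h with hk | hnn | hcol | horth
    · obtain ⟨u, hu, hpos⟩ := exists_sign_mul_nonneg hk (A := Cᵀ * C)
        (fun i => by rw [← Matrix.inner_col_col]; exact real_inner_self_nonneg)
        (fun i j => by rw [← Matrix.inner_col_col, real_inner_comm, Matrix.inner_col_col])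
      exact hsign u hu hpos
    · exact hsign (fun _ => 1) (by simp) (by simpa using hnn)
    · exact Matrix.frobenius_norm_mul_le_one_of_colinear_row hcube' hG hcol
    · exact Matrix.frobenius_norm_mul_le_one_of_orthogonal_row hcube' hG horth
  · have h := sum_inner_mul_inner_le_pi_div_two _ hcube _ hG
    rw [← Matrix.frobenius_norm_mul_sq] at h
    -- `h` bounds the square by `π / 2`, which is stronger than needed because `π / 2 > 1`.
    nlinarith [Real.pi_gt_three]
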